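/- Let $X,Y,Z$ be Archimedean Riesz spaces with $Z$ Dedekind complete and weakly $\sigma$-distributive (i.e. $\bigwedge_{\varphi\in\mathbb N^{\mathbb N}}\bigvee_i a_{i\varphi(i)}=0$ for every regulator $(a_{ij})$, a regulator, or $(D)$-sequence, being a bounded double sequence with $a_{ij}\downarrow_j 0$ for each $i$). A net $(x_i)$ *order converges* to $x$ if there are an increasing net $(z_c)$ and a decreasing net $(y_c)$ over a common directed set with $\sup_c z_c=x=\inf_c y_c$ such that for each $c$ eventually $z_c\le x_i\le y_c$; it *$(D)$-converges* to $x$ if there is a regulator $(a_{ij})$ such that for each $\varphi\in\mathbb N^{\mathbb N}$ eventually $|x_i-x|\le\bigvee_j a_{j\varphi(j)}$. Equip $X,Y$ with order convergence and $Z$ with a convergence $\eta$ that is either order convergence or $(D)$-convergence. Let $X\times Y\to Z$, $(x,y)\mapsto xy$, be bilinear, isotone on the positive cones, with each partial map $x\mapsto xy$, $y\mapsto xy$ continuous (it maps order convergent nets to $\eta$-convergent nets with the corresponding limit). Let $(\Omega,\mathcal H)$ be a measurable space and $\mu:\mathcal H\to Y^+$ be $\sigma$-additive: $\mu(\bigcup_n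 A_n)$ is the order limit of $\sum_{j\in J}\mu(A_j)$ over the finite $J\subset\mathbb N$, for all disjoint sequences $(A_n)$ in $\mathcal H$. *Pavlakos integral.* An elementary function is one of the form $f=\sum_{n=1}^\infty a_n\mathbb 1_{A_n}$ with $a_n\in X$ and disjoint $A_n\in\mathcal H$. If $f\ge0$, it is integrable if the order limit $\int^P_\Omega f\,d\mu=(o)\text{-}\lim_n\sum_{i\le n}a_i\mu(A_i)$ exists in $Z$; a general elementary $f$ is integrable if $f^+$ and $f^-$ are, and then $\int^P_\Omega f\,d\mu=\int^P_\Omega f^+d\mu-\int^P_\Omega f^-d\mu$. Write $(u)\text{-}\lim f_n=f$ a.e. if there are $N\in\mathcal H$ with $\mu(N)=0$ and a sequence $u_n\downarrow0$ in $X$ with $|f_n(\omega)-f(\omega)|\le u_n$ for all $n$ and all $\omega\in\Omega\setminus N$. A function $f:\Omega\to X$ which is such a limit of elementary functions is Pavlakos integrable if there is an increasing sequence of integrable elementary functions $f_n$ with $(u)\text{-}\lim f_n=f$ a.e.; then $\int^P_\Omega f\,d\mu=(o)\text{-}\lim_n\int^P_\Omega f_n\,d\mu$. *$S^*$-partition integral.*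 Order the set $\mathcal P(\Omega)$ of countable partitions of $\Omega$ into nonempty sets of $\mathcal H$ by refinement. A choice function $\delta$ assigns to each nonempty $\alpha\subseteq\Omega$ a point $\delta_\alpha\in\alpha$. A function $f:\Omega\to X$ is $S^*$-partition integrable on $\Omega$ with integral $z\in Z$ if for every choice function $\delta$ the unconditional series $\sum_{\alpha\in P}f(\delta_\alpha)\mu(\alpha)$ ($\eta$-limit of its finite subsums) converges for all $P$ refining some fixed $P_0\in\mathcal P(\Omega)$, and the net of these sums $\eta$-converges to $z$ along $\mathcal P(\Omega)$. **Theorem.** Let $f:\Omega\to X$ be Pavlakos integrable on $\Omega$ (non-negative or not). Then $f$ is $S^*$-partition integrable on $\Omega$, and the two integrals, which are uniquely determined, coincide: $\int^{S^*}_\Omega f\,d\mu=\int^P_\Omega f\,d\mu$. -/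

import Mathlib

/-!
Riesz spaces are spelled out with Mathlib classes: `[AddCommGroup X] [Lattice X]
[IsOrderedAddMonoid X] [Module ℝ X] [IsOrderedModule ℝ X]`.
-/

universe u v w

section OrderNotions

variable {X : Type v} [AddCommGroup X] [Lattice X]

/-- The Archimedean property of a Riesz space: if `n • x ≤ y` for all `n`, then `x ≤ 0`.
(Mathlib's class `Archimedean` is a different, much stronger condition for non-linear orders.) -/
def IsArchimedeanRiesz (X : Type v) [AddCommGroup X] [Lattice X] : Prop :=
  ∀ x y : X, (∀ n : ℕ, n • x ≤ y) → x ≤ 0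

/-- Dedekind completeness: every nonempty set that is bounded above has a supremum. -/
def IsDedekindComplete (X : Type v) [Lattice X] : Prop :=
  ∀ S : Set X, S.Nonempty → BddAbove S → ∃ s, IsLUB S s

/-- A `(D)`-sequence (regulator): a bounded double sequence `a i j`, decreasing to `0` as
`j → ∞` for each fixed `i`. -/
def IsRegulator (a : ℕ → ℕ → X) : Prop :=
  (∃ b, ∀ i j, a i j ≤ b) ∧ ∀ i, Antitone (a i) ∧ IsGLB (Set.range (a i)) 0

/-- Weak `σ`-distributivity: `⋀_φ ⋁_i a i (φ i) = 0` for every regulator `a`. -/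
def IsWeaklySigmaDistributive (X : Type v) [AddCommGroup X] [Lattice X] : Prop :=
  ∀ a : ℕ → ℕ → X, IsRegulator a →
    IsGLB {s : X | ∃ φ : ℕ → ℕ, IsLUB (Set.range fun i => a i (φ i)) s} 0

/-- Order convergence of a net `x : I → X` to `l`: there are, on a common directed index set,
an increasing net `lo` with supremum `l` and a decreasing net `up` with infimum `l` such that
each interval `[lo c, up c]` contains a tail of `x`. -/
def OrderLim {I : Type u} [Preorder I] (x : I → X) (l : X) : Prop :=
  ∃ (C : Type v) (_ : Preorder C) (_ : IsDirectedOrder C) (_ : Nonempty C) (lo up : C → X),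
    Monotone lo ∧ Antitone up ∧ IsLUB (Set.range lo) l ∧ IsGLB (Set.range up) l ∧
      ∀ c, ∃ i₀, ∀ i, i₀ ≤ i → lo c ≤ x i ∧ x i ≤ up c

/-- `(D)`-convergence of a net `x : I → X` to `l`: for some regulator `a` and all `φ : ℕ → ℕ`,
eventually `|x i - l| ≤ ⋁_j a j (φ j)`. -/
def DLim {I : Type u} [Preorder I] (x : I → X) (l : X) : Prop :=
  ∃ a : ℕ → ℕ → X, IsRegulator a ∧ ∀ φ : ℕ → ℕ, ∃ s, IsLUB (Set.range fun j => a j (φ j)) s ∧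
    ∃ i₀, ∀ i, i₀ ≤ i → |x i - l| ≤ s

/-- The two net convergences with which the target space may be equipped. -/
inductive ConvMode
  | order
  | regulator

/-- Net convergence in the chosen mode. -/
def ConvMode.Lim (c : ConvMode) {I : Type u} [Preorder I] (x : I → X) (l : X) : Prop :=
  match c with
  | .order => OrderLim x l
  | .regulator => DLim x l

end OrderNotions

section Product

variable {X : Type v} [AddCommGroup X] [Lattice X] [Module ℝ X]
variable {Y : Type w} [AddCommGroup Y] [Lattice Y] [Module ℝ Y]
variable {Z : Type u} [AddCommGroup Z] [Lattice Z] [Module ℝ Z]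

/-- A map between Riesz spaces is continuous from order convergence to convergence in mode `c`.
Nets indexed in the universe of the domain are enough to describe all nets in it. -/
def IsNetContinuous (c : ConvMode) (T : X → Z) : Prop :=
  ∀ (I : Type v) [Preorder I] [IsDirectedOrder I] [Nonempty I] (x : I → X) (l : X),
    OrderLim x l → c.Lim (fun i => T (x i)) (T l)

/-- A product of Riesz spaces `X × Y → Z`: a bilinear map, isotone on the positive cones, each of
whose partial maps is continuous (order convergence on `X`, `Y`; mode `c` on `Z`). -/
structure IsRieszProduct (c : ConvMode) (B : X →ₗ[ℝ] Y →ₗ[ℝ] Z) : Prop where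
  isotone : ∀ x x' : X, ∀ y y' : Y, 0 ≤ x → x ≤ x' → 0 ≤ y → y ≤ y' → B x y ≤ B x' y'
  continuous_left : ∀ y : Y, IsNetContinuous c (fun x : X => B x y)
  continuous_right : ∀ x : X, IsNetContinuous c (fun y : Y => B x y)

end Product

section Integrals

variable {Ω : Type u} [MeasurableSpace Ω]

/-- A positive `σ`-additive measure on the `σ`-algebra of `Ω` with values in a Riesz space; only
the values on measurable sets matter. The series is unconditional, in order convergence. -/
structure IsRieszMeasure {Y : Type w} [AddCommGroup Y] [Lattice Y] (μ : Set Ω → Y) : Prop where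
  nonneg : ∀ A, MeasurableSet A → 0 ≤ μ A
  sigma_additive : ∀ A : ℕ → Set Ω, (∀ n, MeasurableSet (A n)) →
    Pairwise (fun m n => Disjoint (A m) (A n)) →
      OrderLim (fun J : Finset ℕ => ∑ j ∈ J, μ (A j)) (μ (⋃ n, A n))

/-- A countable partition of `A` into nonempty measurable sets. -/
structure MeasPartition (A : Set Ω) where
  cells : Set (Set Ω)
  countable : cells.Countable
  measurable : ∀ α ∈ cells, MeasurableSet α
  nonempty : ∀ α ∈ cells, α.Nonempty
  disjoint : ∀ α ∈ cells, ∀ β ∈ cells, α ≠ β → Disjoint α β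
  covers : ⋃₀ cells = A

/-- Refinement: `P ≤ Q` if every cell of `Q` lies in a cell of `P`. -/
instance MeasPartition.instPreorder (A : Set Ω) : Preorder (MeasPartition A) where
  le P Q := ∀ β ∈ Q.cells, ∃ α ∈ P.cells, β ⊆ α
  le_refl _ β hβ := ⟨β, hβ, subset_rfl⟩
  le_trans _ _ _ h₁ h₂ γ hγ :=
    let ⟨β, hβ, h⟩ := h₂ γ hγ
    let ⟨α, hα, h'⟩ := h₁ β hβ
    ⟨α, hα, h.trans h'⟩

/-- The countable partitions of a measurable set are directed by refinement. -/
instance MeasPartition.instIsDirectedOrder (A : Set Ω) : IsDirectedOrder (MeasPartition A) where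
  directed P Q := by
    refine ⟨⟨{γ | γ.Nonempty ∧ ∃ α ∈ P.cells, ∃ β ∈ Q.cells, γ = α ∩ β}, ?_, ?_, ?_, ?_, ?_⟩,
      ?_, ?_⟩
    · refine ((P.countable.prod Q.countable).image fun p => p.1 ∩ p.2).mono ?_
      rintro γ ⟨-, α, hα, β, hβ, rfl⟩
      exact ⟨(α, β), ⟨hα, hβ⟩, rfl⟩
    · rintro γ ⟨-, α, hα, β, hβ, rfl⟩
      exact (P.measurable α hα).inter (Q.measurable β hβ)
    · exact fun γ h => h.1
    · rintro γ ⟨-, α, hα, β, hβ, rfl⟩ γ' ⟨-, α', hα', β', hβ', rfl⟩ hne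
      by_cases h : α = α'
      · subst h
        have h' : β ≠ β' := fun h' => hne (by rw [h'])
        exact (Q.disjoint β hβ β' hβ' h').mono Set.inter_subset_right Set.inter_subset_right
      · exact (P.disjoint α hα α' hα' h).mono Set.inter_subset_left Set.inter_subset_left
    · ext ω
      constructor
      · rintro ⟨γ, ⟨-, α, hα, β, hβ, rfl⟩, hω⟩
        rw [← P.covers]
        exact ⟨α, hα, hω.1⟩
      · intro hω
        obtain ⟨α, hα, h₁⟩ : ω ∈ ⋃₀ P.cells := by rw [P.covers]; exact hω
        obtain ⟨β, hβ, h₂⟩ : ω ∈ ⋃₀ Q.cells := by rw [Q.covers]; exact hω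
        exact ⟨α ∩ β, ⟨⟨ω, h₁, h₂⟩, α, hα, β, hβ, rfl⟩, h₁, h₂⟩
    · rintro γ ⟨-, α, hα, β, hβ, rfl⟩
      exact ⟨α, hα, Set.inter_subset_left⟩
    · rintro γ ⟨-, α, hα, β, hβ, rfl⟩
      exact ⟨β, hβ, Set.inter_subset_right⟩

/-- A measurable set has a countable measurable partition. -/
theorem MeasPartition.nonempty_of_measurableSet {A : Set Ω} (hA : MeasurableSet A) :
    Nonempty (MeasPartition A) := by
  refine ⟨⟨{α | α = A ∧ α.Nonempty}, ?_, ?_, ?_, ?_, ?_⟩⟩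
  · exact (Set.countable_singleton A).mono fun α h => h.1
  · rintro α ⟨rfl, -⟩
    exact hA
  · exact fun α h => h.2
  · rintro α ⟨rfl, -⟩ β ⟨rfl, -⟩ h
    exact absurd rfl h
  · ext ω
    constructor
    · rintro ⟨α, ⟨rfl, -⟩, hω⟩
      exact hω
    · exact fun hω => ⟨A, ⟨rfl, ⟨ω, hω⟩⟩, hω⟩

/-- A choice function: it picks a point of every nonempty subset of `Ω`. -/
abbrev ChoiceFunction (Ω : Type u) : Type u := (α : {α : Set Ω // α.Nonempty}) → α.1

variable {X : Type*} [AddCommGroup X] [Lattice X] [Module ℝ X]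
variable {Y : Type*} [AddCommGroup Y] [Lattice Y] [Module ℝ Y]
variable {Z : Type*} [AddCommGroup Z] [Lattice Z] [Module ℝ Z]

/-- The finite subsums of the series `∑_{α ∈ P} f(δ_α) μ(α)`. -/
def partitionSums (B : X →ₗ[ℝ] Y →ₗ[ℝ] Z) (μ : Set Ω → Y) (f : Ω → X) (δ : ChoiceFunction Ω)
    {A : Set Ω} (P : MeasPartition A) (J : Finset P.cells) : Z :=
  ∑ α ∈ J, B (f (δ ⟨α.1, P.nonempty α.1 α.2⟩)) (μ α.1)

/-- `z` is the `S*`-partition integral of `f` on `A`: for every choice function `δ` the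
unconditional series `S P = ∑_{α ∈ P} f(δ_α) μ(α)` converges for all partitions `P` of `A` that
refine a fixed one, and the net `S` of these sums converges to `z` along refinement. Both limits
are taken in mode `c`. -/
def HasSStarPartitionIntegral (c : ConvMode) (B : X →ₗ[ℝ] Y →ₗ[ℝ] Z) (μ : Set Ω → Y)
    (A : Set Ω) (f : Ω → X) (z : Z) : Prop :=
  ∀ δ : ChoiceFunction Ω, ∃ S : MeasPartition A → Z,
    (∃ P₀, ∀ P, P₀ ≤ P → c.Lim (partitionSums B μ f δ P) (S P)) ∧ c.Lim S z

/-- `f = ∑_n a_n 1_{A_n}` with `(A_n)` a sequence of disjoint measurable sets. -/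
structure IsElementaryRep (f : Ω → X) (a : ℕ → X) (A : ℕ → Set Ω) : Prop where
  measurable : ∀ n, MeasurableSet (A n)
  disjoint : Pairwise fun m n => Disjoint (A m) (A n)
  eq_on : ∀ n, ∀ ω ∈ A n, f ω = a n
  eq_zero : ∀ ω, ω ∉ ⋃ n, A n → f ω = 0

/-- Elementary functions. -/
def IsElementary (f : Ω → X) : Prop := ∃ a A, IsElementaryRep f a A

/-- The integral of a non-negative elementary function `∑_n a_n 1_{A_n}`: the order limit of the
partial sums of `∑_n a_n μ(A_n)`. -/
def HasElementaryIntegralNonneg (B : X →ₗ[ℝ] Y →ₗ[ℝ] Z) (μ : Set Ω → Y) (f : Ω → X) (z : Z) :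
    Prop :=
  0 ≤ f ∧ ∃ a A, IsElementaryRep f a A ∧
    OrderLim (fun n : ℕ => ∑ i ∈ Finset.range n, B (a i) (μ (A i))) z

/-- The integral of an elementary function `f`: that of `f⁺` minus that of `f⁻`. -/
def HasElementaryIntegral (B : X →ₗ[ℝ] Y →ₗ[ℝ] Z) (μ : Set Ω → Y) (f : Ω → X) (z : Z) : Prop :=
  IsElementary f ∧ ∃ z₁ z₂, HasElementaryIntegralNonneg B μ f⁺ z₁ ∧
    HasElementaryIntegralNonneg B μ f⁻ z₂ ∧ z = z₁ - z₂

/-- Uniform convergence in order, almost everywhere: off a measurable null set,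
`|F n - f| ≤ u n` for some sequence `u n` decreasing to `0`. -/
def UniformLimAE (μ : Set Ω → Y) (F : ℕ → Ω → X) (f : Ω → X) : Prop :=
  ∃ N, MeasurableSet N ∧ μ N = 0 ∧ ∃ u : ℕ → X, Antitone u ∧ IsGLB (Set.range u) 0 ∧
    ∀ n, ∀ ω, ω ∉ N → |F n ω - f ω| ≤ u n

/-- The `μ`-measurable functions: a.e. uniform order limits of elementary functions. -/
def IsMuMeasurable (μ : Set Ω → Y) (f : Ω → X) : Prop :=
  ∃ F : ℕ → Ω → X, (∀ n, IsElementary (F n)) ∧ UniformLimAE μ F f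

/-- `f` is Pavlakos integrable on `Ω`: it is the a.e. uniform order limit of an increasing
sequence of integrable elementary functions. -/
def PavlakosIntegrable (B : X →ₗ[ℝ] Y →ₗ[ℝ] Z) (μ : Set Ω → Y) (f : Ω → X) : Prop :=
  IsMuMeasurable μ f ∧ ∃ F : ℕ → Ω → X, Monotone F ∧
    (∀ n, ∃ z, HasElementaryIntegral B μ (F n) z) ∧ UniformLimAE μ F f

/-- `z` is a Pavlakos integral of `f` on `Ω`: the order limit of the integrals of some sequence
as in `PavlakosIntegrable`. -/
def HasPavlakosIntegral (B : X →ₗ[ℝ] Y →ₗ[ℝ] Z) (μ : Set Ω → Y) (f : Ω → X) (z : Z) : Prop :=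
  IsMuMeasurable μ f ∧ ∃ F : ℕ → Ω → X, Monotone F ∧ UniformLimAE μ F f ∧
    ∃ s : ℕ → Z, (∀ n, HasElementaryIntegral B μ (F n) (s n)) ∧ OrderLim s z

end Integrals

/-! ### Order limits, (D)-limits, and limits controlled by a sequence -/

section OrderLimits

variable {Z : Type v} [Lattice Z]

/-! On a partition fine enough to be adapted to the level sets of an elementary function `F`, tagged
sums of `F` do not depend on the tags. By `σ`-additivity and interchange of positive double series
they equal the integral of `F` exactly (`HasElementaryIntegralNonneg.exists_hasPosSum`,
`HasElementaryIntegral.exists_hasAbsSum`).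

If `|F - f| ≤ u` off a null set `N` and the partition also separates `N` from its complement, then
the terms for `f` and `F` on a cell `α` differ by at most `B u (μ α)`. These bounds add up to `B u
(μ Ω)`, so by Dedekind completeness the series for `f` converges, to within `B u (μ Ω)` of the
integral of `F` (`HasElementaryIntegral.exists_abs_sub_le`).

Let `F n` increase to `f` with errors `u n` and integrals `s n`, and let `z = sup s n`. Fine
partition sums of `f` are then within `B (u n) (μ Ω) + (z - s n)` of `z`. This is one sequence
decreasing to `0`, the same for all tags, and such a bound yields order convergence and
(D)-convergence alike (`SeqLim.lim`). Conversely, weak `σ`-distributivity turns every (D)-limit into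
an order limit. Continuity of the product and uniqueness of limits are therefore always used in
order form.

The `s n` are bounded because each is close to a partition sum of `f`, so a Pavlakos integral
exists. Every Pavlakos integral is an `S*`-integral, so uniqueness of the latter settles both. -/

theorem OrderLim.isLUB_of_monotone {I : Type u} [Preorder I] [IsDirectedOrder I] {x : I → Z}
    {l : Z} (h : OrderLim x l) (hx : Monotone x) : IsLUB (Set.range x) l := by
  obtain ⟨C, _, _, _, lo, up, -, -, hlo, hup, hc⟩ := h
  constructor
  · rintro _ ⟨i, rfl⟩
    refine hup.2 ?_
    rintro _ ⟨c, rfl⟩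
    obtain ⟨i₀, h₀⟩ := hc c
    obtain ⟨j, hij, hj⟩ := exists_ge_ge i i₀
    exact (hx hij).trans (h₀ j hj).2
  · intro b hb
    refine hlo.2 ?_
    rintro _ ⟨c, rfl⟩
    obtain ⟨i₀, h₀⟩ := hc c
    exact (h₀ i₀ le_rfl).1.trans (hb ⟨i₀, rfl⟩)

theorem OrderLim.isGLB_of_antitone {I : Type u} [Preorder I] [IsDirectedOrder I] {x : I → Z}
    {l : Z} (h : OrderLim x l) (hx : Antitone x) : IsGLB (Set.range x) l := by
  obtain ⟨C, _, _, _, lo, up, -, -, hlo, hup, hc⟩ := h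
  constructor
  · rintro _ ⟨i, rfl⟩
    refine hlo.2 ?_
    rintro _ ⟨c, rfl⟩
    obtain ⟨i₀, h₀⟩ := hc c
    obtain ⟨j, hij, hj⟩ := exists_ge_ge i i₀
    exact (h₀ j hj).1.trans (hx hij)
  · intro b hb
    refine hup.2 ?_
    rintro _ ⟨c, rfl⟩
    obtain ⟨i₀, h₀⟩ := hc c
    exact (hb ⟨i₀, rfl⟩).trans (h₀ i₀ le_rfl).2

theorem orderLim_of_monotone_of_isLUB {I : Type v} [Preorder I] [IsDirectedOrder I] [Nonempty I]
    {x : I → Z} {l : Z} (hx : Monotone x) (h : IsLUB (Set.range x) l) : OrderLim x l :=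
  ⟨I, _, ‹_›, ‹_›, x, fun _ => l, hx, antitone_const, h, by simp,
    fun c => ⟨c, fun i hi => ⟨hx hi, h.1 ⟨i, rfl⟩⟩⟩⟩

theorem orderLim_of_antitone_of_isGLB {I : Type v} [Preorder I] [IsDirectedOrder I] [Nonempty I]
    {x : I → Z} {l : Z} (hx : Antitone x) (h : IsGLB (Set.range x) l) : OrderLim x l :=
  ⟨I, _, ‹_›, ‹_›, fun _ => l, x, monotone_const, hx, by simp, h,
    fun c => ⟨c, fun i hi => ⟨h.1 ⟨i, rfl⟩, hx hi⟩⟩⟩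

/-- At a sufficiently late common index, every lower bracket of `x` lies below every upper bracket
of `y`. Applied in both directions, this gives uniqueness of order limits. -/
theorem OrderLim.le_of_orderLim {I : Type u} [Preorder I] [IsDirectedOrder I] {x y : I → Z}
    {l m : Z} (hx : OrderLim x l) (hy : OrderLim y m) {i₀ : I} (h : ∀ i, i₀ ≤ i → x i ≤ y i) :
    l ≤ m := by
  obtain ⟨C, _, _, _, lo, up, -, -, hlo, -, hc⟩ := hx
  obtain ⟨D, _, _, _, lo', up', -, -, -, hup', hd⟩ := hy
  refine hlo.2 ?_
  rintro _ ⟨c, rfl⟩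
  refine hup'.2 ?_
  rintro _ ⟨d, rfl⟩
  obtain ⟨i₁, h₁⟩ := hc c
  obtain ⟨i₂, h₂⟩ := hd d
  obtain ⟨j, hj₁, hj₂⟩ := exists_ge_ge i₁ i₂
  obtain ⟨k, hk, hk₀⟩ := exists_ge_ge j i₀
  exact (h₁ k (hj₁.trans hk)).1.trans ((h k hk₀).trans (h₂ k (hj₂.trans hk)).2)

instance ULift.instIsDirectedOrder {I : Type u} [Preorder I] [IsDirectedOrder I] :
    IsDirectedOrder (ULift.{v} I) where
  directed a b :=
    let ⟨c, hac, hbc⟩ := exists_ge_ge a.down b.down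
    ⟨⟨c⟩, hac, hbc⟩

theorem ULift.range_comp_down {I : Type u} {α : Type w} (x : I → α) :
    Set.range (fun i : ULift.{v} I => x i.down) = Set.range x :=
  ULift.down_surjective.range_comp x

variable [AddCommGroup Z]

/-- The net `x` is eventually within each term of some sequence decreasing to `0` of `l`. -/
def SeqLim {I : Type u} [Preorder I] (x : I → Z) (l : Z) : Prop :=
  ∃ e : ℕ → Z, Antitone e ∧ IsGLB (Set.range e) 0 ∧
    ∀ n, ∃ i₀, ∀ i, i₀ ≤ i → |x i - l| ≤ e n

/-- The regulator with all rows equal to `e` works: `φ` attains its minimum at some `k`, and `e` is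
antitone, so the supremum of the `e (φ j)` is the single term `e (φ k)`. -/
theorem SeqLim.dLim {I : Type u} [Preorder I] {x : I → Z} {l : Z} (h : SeqLim x l) :
    DLim x l := by
  obtain ⟨e, hm, he, hx⟩ := h
  refine ⟨fun _ => e, ⟨⟨e 0, fun _ j => hm j.zero_le⟩, fun _ => ⟨hm, he⟩⟩, fun φ => ?_⟩
  obtain ⟨k, hk⟩ : ∃ k, ∀ j, φ k ≤ φ j := by
    obtain ⟨k, -, hk⟩ := WellFounded.has_min (measure φ).wf Set.univ ⟨0, trivial⟩
    exact ⟨k, fun j => not_lt.1 (hk j trivial)⟩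
  refine ⟨e (φ k), IsGreatest.isLUB ⟨⟨k, rfl⟩, ?_⟩, hx (φ k)⟩
  rintro _ ⟨j, rfl⟩
  exact hm (hk j)

variable [IsOrderedAddMonoid Z]

/-- Reduces rearranging an inequality to a group identity, which `abel` can check without a linear
order. -/
theorem le_of_sub_eq_sub {a b c d : Z} (h : c ≤ d) (e : b - a = d - c) : a ≤ b := by
  rw [← sub_nonneg, e]
  exact sub_nonneg.2 h

theorem le_of_abs_sub_le {a b c : Z} (h : |a - b| ≤ c) : b - c ≤ a ∧ a ≤ b + c :=
  ⟨le_of_sub_eq_sub (abs_le'.1 h).2 (by abel), le_of_sub_eq_sub (abs_le'.1 h).1 (by abel)⟩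

theorem abs_sub_le_of_le {a b c : Z} (h₁ : b - c ≤ a) (h₂ : a ≤ b + c) : |a - b| ≤ c :=
  abs_le'.2 ⟨le_of_sub_eq_sub h₂ (by abel), le_of_sub_eq_sub h₁ (by abel)⟩

theorem isLUB_range_sub {ι : Type*} {e : ι → Z} (he : IsGLB (Set.range e) 0) (l : Z) :
    IsLUB (Set.range fun i => l - e i) l := by
  constructor
  · rintro _ ⟨i, rfl⟩
    exact sub_le_self _ (he.1 ⟨i, rfl⟩)
  · intro b hb
    refine sub_nonpos.1 (he.2 ?_)
    rintro _ ⟨i, rfl⟩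
    exact sub_le_comm.1 (hb ⟨i, rfl⟩)

theorem isGLB_range_add {ι : Type*} {e : ι → Z} (he : IsGLB (Set.range e) 0) (l : Z) :
    IsGLB (Set.range fun i => l + e i) l := by
  constructor
  · rintro _ ⟨i, rfl⟩
    exact le_add_of_nonneg_right (he.1 ⟨i, rfl⟩)
  · intro b hb
    refine sub_nonpos.1 (he.2 ?_)
    rintro _ ⟨i, rfl⟩
    exact sub_le_iff_le_add'.2 (hb ⟨i, rfl⟩)

theorem isGLB_range_sub_of_isLUB {ι : Type*} {x : ι → Z} {l : Z} (h : IsLUB (Set.range x) l) :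
    IsGLB (Set.range fun i => l - x i) 0 := by
  constructor
  · rintro _ ⟨i, rfl⟩
    exact sub_nonneg.2 (h.1 ⟨i, rfl⟩)
  · intro b hb
    have : l ≤ l - b := by
      refine h.2 ?_
      rintro _ ⟨i, rfl⟩
      exact le_sub_comm.1 (hb ⟨i, rfl⟩)
    exact le_of_sub_eq_sub this (by abel)

theorem isGLB_range_add_antitone {e e' : ℕ → Z} (ha : Antitone e) (ha' : Antitone e')
    (he : IsGLB (Set.range e) 0) (he' : IsGLB (Set.range e') 0) :
    IsGLB (Set.range fun n => e n + e' n) 0 := by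
  constructor
  · rintro _ ⟨n, rfl⟩
    exact add_nonneg (he.1 ⟨n, rfl⟩) (he'.1 ⟨n, rfl⟩)
  · intro b hb
    refine he.2 ?_
    rintro _ ⟨m, rfl⟩
    refine sub_nonpos.1 (he'.2 ?_)
    rintro _ ⟨n, rfl⟩
    refine sub_le_iff_le_add'.2 ((hb ⟨max m n, rfl⟩).trans ?_)
    exact add_le_add (ha (le_max_left _ _)) (ha' (le_max_right _ _))

theorem SeqLim.orderLim {I : Type u} [Preorder I] {x : I → Z} {l : Z} (h : SeqLim x l) :
    OrderLim x l := by
  obtain ⟨e, hm, he, hx⟩ := h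
  refine ⟨ULift ℕ, inferInstance, inferInstance, inferInstance, fun n => l - e n.down,
    fun n => l + e n.down, fun m n h => sub_le_sub_left (hm h) _,
    fun m n h => add_le_add_right (hm h) _, ?_, ?_, ?_⟩
  · rw [ULift.range_comp_down fun n => l - e n]
    exact isLUB_range_sub he l
  · rw [ULift.range_comp_down fun n => l + e n]
    exact isGLB_range_add he l
  · intro n
    obtain ⟨i₀, h₀⟩ := hx n.down
    exact ⟨i₀, fun i hi => le_of_abs_sub_le (h₀ i hi)⟩

theorem SeqLim.lim (c : ConvMode) {I : Type u} [Preorder I] {x : I → Z} {l : Z}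
    (h : SeqLim x l) : c.Lim x l := by
  cases c
  exacts [h.orderLim, h.dLim]

/-- The suprema `s φ` form a decreasing net over the directed set `ℕ → ℕ`, and weak
`σ`-distributivity says exactly that its infimum is `0`. -/
theorem DLim.orderLim (hZ : IsWeaklySigmaDistributive Z) {I : Type u} [Preorder I] {x : I → Z}
    {l : Z} (h : DLim x l) : OrderLim x l := by
  obtain ⟨a, ha, hx⟩ := h
  choose s hs hx using hx
  have hm : Antitone s := fun φ ψ hφψ => by
    refine (hs ψ).2 ?_
    rintro _ ⟨j, rfl⟩
    exact ((ha.2 j).1 (hφψ j)).trans ((hs φ).1 ⟨j, rfl⟩)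
  have hg : IsGLB (Set.range s) 0 := by
    convert hZ a ha using 1
    ext t
    exact ⟨fun ⟨φ, h⟩ => ⟨φ, h ▸ hs φ⟩, fun ⟨φ, h⟩ => ⟨φ, (hs φ).unique h⟩⟩
  refine ⟨ULift (ℕ → ℕ), inferInstance, inferInstance, inferInstance, fun φ => l - s φ.down,
    fun φ => l + s φ.down, fun φ ψ h => sub_le_sub_left (hm h) _,
    fun φ ψ h => add_le_add_right (hm h) _, ?_, ?_, ?_⟩
  · rw [ULift.range_comp_down fun φ => l - s φ]
    exact isLUB_range_sub hg l
  · rw [ULift.range_comp_down fun φ => l + s φ]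
    exact isGLB_range_add hg l
  · intro φ
    obtain ⟨i₀, h₀⟩ := hx φ.down
    exact ⟨i₀, fun i hi => le_of_abs_sub_le (h₀ i hi)⟩

theorem ConvMode.Lim.orderLim {c : ConvMode} (hZ : IsWeaklySigmaDistributive Z) {I : Type u}
    [Preorder I] {x : I → Z} {l : Z} (h : c.Lim x l) : OrderLim x l := by
  cases c
  exacts [h, DLim.orderLim hZ h]

end OrderLimits

/-! ### Positive and absolutely convergent unconditional sums -/

section Sums

variable {Z : Type v} [AddCommGroup Z] [Lattice Z]
variable {ι : Type u} {κ : Type w}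

/-- `z` is the sum of the non-negative family `g`. -/
def HasPosSum (g : ι → Z) (z : Z) : Prop :=
  (∀ i, 0 ≤ g i) ∧ IsLUB (Set.range fun J : Finset ι => ∑ i ∈ J, g i) z

/-- `z` is the sum of the absolutely summable family `g`. -/
def HasAbsSum (g : ι → Z) (z : Z) : Prop :=
  ∃ p q zp zq, HasPosSum p zp ∧ HasPosSum q zq ∧ (∀ i, g i = p i - q i) ∧ z = zp - zq

theorem hasPosSum_zero : HasPosSum (fun _ : ι => (0 : Z)) 0 :=
  ⟨fun _ => le_rfl, by simp⟩

theorem HasPosSum.sum_le {g : ι → Z} {z : Z} (h : HasPosSum g z) (J : Finset ι) :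
    ∑ i ∈ J, g i ≤ z :=
  h.2.1 ⟨J, rfl⟩

theorem HasPosSum.le_of_forall_sum_le {g : ι → Z} {z b : Z} (h : HasPosSum g z)
    (hb : ∀ J : Finset ι, ∑ i ∈ J, g i ≤ b) : z ≤ b :=
  h.2.2 (by rintro _ ⟨J, rfl⟩; exact hb J)

theorem HasPosSum.hasAbsSum {g : ι → Z} {z : Z} (h : HasPosSum g z) : HasAbsSum g z :=
  ⟨g, fun _ => 0, z, 0, h, hasPosSum_zero, by simp, by simp⟩

theorem hasPosSum_single {g : ι → Z} (i : ι) (hi : 0 ≤ g i) (h : ∀ j, j ≠ i → g j = 0) :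
    HasPosSum g (g i) := by
  have hg : ∀ j, 0 ≤ g j := fun j => by
    by_cases hj : j = i
    · exact hj ▸ hi
    · exact (h j hj).ge
  refine ⟨hg, IsGreatest.isLUB ⟨⟨{i}, by simp⟩, ?_⟩⟩
  rintro _ ⟨J, rfl⟩
  by_cases hJ : i ∈ J
  · exact (Finset.sum_eq_single_of_mem i hJ fun j _ => h j).le
  · simpa [Finset.sum_eq_zero fun j hj => h j (by rintro rfl; exact hJ hj)] using hi

variable [IsOrderedAddMonoid Z]

theorem HasPosSum.mono {g h : ι → Z} {z w : Z} (hg : HasPosSum g z) (hh : HasPosSum h w)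
    (hle : ∀ i, g i ≤ h i) : z ≤ w :=
  hg.le_of_forall_sum_le fun J => (Finset.sum_le_sum fun i _ => hle i).trans (hh.sum_le J)

theorem HasPosSum.exists_of_le (hZ : IsDedekindComplete Z) {g h : ι → Z} {w : Z}
    (hg : ∀ i, 0 ≤ g i) (hle : ∀ i, g i ≤ h i) (hh : HasPosSum h w) : ∃ z, HasPosSum g z := by
  obtain ⟨z, hz⟩ := hZ (Set.range fun J : Finset ι => ∑ i ∈ J, g i) (Set.range_nonempty _) <| by
    refine ⟨w, ?_⟩
    rintro _ ⟨J, rfl⟩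
    exact (Finset.sum_le_sum fun i _ => hle i).trans (hh.sum_le J)
  exact ⟨z, hg, hz⟩

theorem HasPosSum.add {g h : ι → Z} {z w : Z} (hg : HasPosSum g z) (hh : HasPosSum h w) :
    HasPosSum (fun i => g i + h i) (z + w) := by
  classical
  refine ⟨fun i => add_nonneg (hg.1 i) (hh.1 i), ?_, fun b hb => ?_⟩
  · rintro _ ⟨J, rfl⟩
    simpa only [Finset.sum_add_distrib] using add_le_add (hg.sum_le J) (hh.sum_le J)
  · refine le_sub_iff_add_le.1 (hg.le_of_forall_sum_le fun J => ?_)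
    refine le_sub_comm.1 (hh.le_of_forall_sum_le fun K => ?_)
    refine le_sub_iff_add_le'.2 (le_trans ?_ (hb ⟨J ∪ K, rfl⟩))
    simp only [Finset.sum_add_distrib]
    exact add_le_add
      (Finset.sum_le_sum_of_subset_of_nonneg Finset.subset_union_left fun i _ _ => hg.1 i)
      (Finset.sum_le_sum_of_subset_of_nonneg Finset.subset_union_right fun i _ _ => hh.1 i)

theorem HasPosSum.finset_sum {g : κ → ι → Z} {z : κ → Z} (h : ∀ k, HasPosSum (g k) (z k))
    (K : Finset κ) : HasPosSum (fun i => ∑ k ∈ K, g k i) (∑ k ∈ K, z k) := by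
  classical
  induction K using Finset.induction_on with
  | empty => simpa using hasPosSum_zero
  | insert k K hk ih => simpa only [Finset.sum_insert hk] using (h k).add ih

/-- Interchange of a positive double series: a finite sum of columns is itself a sum over rows,
dominated by `r`, and symmetrically. -/
theorem HasPosSum.swap {g : ι → κ → Z} {r : ι → Z} {s : κ → Z} {z : Z}
    (hr : ∀ i, HasPosSum (g i) (r i)) (hs : ∀ k, HasPosSum (fun i => g i k) (s k))
    (h : HasPosSum r z) : HasPosSum s z := by
  refine ⟨fun k => (hs k).sum_le ∅, ?_, fun b hb => ?_⟩
  · rintro _ ⟨K, rfl⟩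
    exact (HasPosSum.finset_sum hs K).mono h fun i => (hr i).sum_le K
  · refine h.le_of_forall_sum_le fun I => ?_
    refine (HasPosSum.finset_sum hr I).le_of_forall_sum_le fun K => ?_
    exact (Finset.sum_le_sum fun k _ => (hs k).sum_le I).trans (hb ⟨K, rfl⟩)

omit [IsOrderedAddMonoid Z] in
theorem HasPosSum.of_extend {e : ι → κ} (he : e.Injective) {g : ι → Z} {z : Z}
    (h : HasPosSum (Function.extend e g 0) z) : HasPosSum g z := by
  classical
  refine ⟨fun i => by simpa [he.extend_apply] using h.1 (e i), ?_, fun b hb => ?_⟩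
  · rintro _ ⟨J, rfl⟩
    simpa [Finset.sum_image he.injOn, he.extend_apply] using h.sum_le (J.image e)
  · refine h.le_of_forall_sum_le fun K => ?_
    rw [← Finset.sum_preimage e K he.injOn _ fun k _ hk => Function.extend_apply' g (0 : κ → Z) k hk]
    simpa only [he.extend_apply] using hb ⟨K.preimage e he.injOn, rfl⟩

theorem HasPosSum.of_range {g : ℕ → Z} {z : Z} (hg : ∀ n, 0 ≤ g n)
    (h : IsLUB (Set.range fun n => ∑ i ∈ Finset.range n, g i) z) : HasPosSum g z := by
  refine ⟨hg, ?_, fun b hb => h.2 ?_⟩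
  · rintro _ ⟨J, rfl⟩
    obtain ⟨n, hn⟩ := J.exists_nat_subset_range
    exact (Finset.sum_le_sum_of_subset_of_nonneg hn fun i _ _ => hg i).trans (h.1 ⟨n, rfl⟩)
  · rintro _ ⟨n, rfl⟩
    exact hb ⟨_, rfl⟩

theorem HasPosSum.monotone_sum {g : ι → Z} (hg : ∀ i, 0 ≤ g i) :
    Monotone fun J : Finset ι => ∑ i ∈ J, g i :=
  fun _ _ h => Finset.sum_le_sum_of_subset_of_nonneg h fun i _ _ => hg i

/-- Countability gives an increasing sequence of finite sets exhausting `ι`. The remainders along it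
replace the net of all remainders by a sequence. -/
theorem HasPosSum.exists_antitone [Countable ι] {g : ι → Z} {z : Z} (h : HasPosSum g z) :
    ∃ e : ℕ → Z, Antitone e ∧ IsGLB (Set.range e) 0 ∧
      ∀ n, ∃ J₀ : Finset ι, ∀ J, J₀ ≤ J → z - ∑ i ∈ J, g i ≤ e n := by
  obtain ⟨f, hf⟩ := exists_injective_nat ι
  let K : ℕ → Finset ι := fun n => (Finset.range n).preimage f hf.injOn
  have hK : Monotone K := fun m n hmn => Finset.monotone_preimage hf (Finset.range_mono hmn)
  have hs := HasPosSum.monotone_sum h.1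
  refine ⟨fun n => z - ∑ i ∈ K n, g i, fun m n hmn => sub_le_sub_left (hs (hK hmn)) _, ?_,
    fun n => ⟨K n, fun J hJ => sub_le_sub_left (hs hJ) _⟩⟩
  refine isGLB_range_sub_of_isLUB ⟨?_, fun b hb => h.le_of_forall_sum_le fun J => ?_⟩
  · rintro _ ⟨n, rfl⟩
    exact h.sum_le _
  · obtain ⟨n, hn⟩ := (J.image f).exists_nat_subset_range
    refine le_trans (hs fun i hi => ?_) (hb ⟨n, rfl⟩)
    exact Finset.mem_preimage.2 (hn (Finset.mem_image_of_mem f hi))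

theorem HasAbsSum.add {g h : ι → Z} {z w : Z} (hg : HasAbsSum g z) (hh : HasAbsSum h w) :
    HasAbsSum (fun i => g i + h i) (z + w) := by
  obtain ⟨p, q, zp, zq, hp, hq, hgp, rfl⟩ := hg
  obtain ⟨p', q', zp', zq', hp', hq', hhp, rfl⟩ := hh
  exact ⟨_, _, _, _, hp.add hp', hq.add hq', fun i => by simp only [hgp, hhp]; abel, by abel⟩

/-- Moving the negative parts across leaves a comparison of positive sums. By antisymmetry, the sum
does not depend on the chosen decomposition. -/
theorem HasAbsSum.mono {g h : ι → Z} {z w : Z} (hg : HasAbsSum g z) (hh : HasAbsSum h w)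
    (hle : ∀ i, g i ≤ h i) : z ≤ w := by
  obtain ⟨p, q, zp, zq, hp, hq, hgp, rfl⟩ := hg
  obtain ⟨p', q', zp', zq', hp', hq', hhp, rfl⟩ := hh
  refine le_of_sub_eq_sub ((hp.add hq').mono (hp'.add hq) fun i => ?_)
    (by abel : _ = (zp' + zq) - (zp + zq'))
  have := hle i
  rw [hgp, hhp] at this
  exact le_of_sub_eq_sub this (by abel)

theorem HasAbsSum.abs_sub_le {g h d : ι → Z} {z w b : Z} (hg : HasAbsSum g z)
    (hh : HasAbsSum h w) (hd : HasPosSum d b) (hle : ∀ i, |g i - h i| ≤ d i) : |z - w| ≤ b :=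
  abs_sub_le_of_le
    (sub_le_iff_le_add.2 <| hh.mono (hg.add hd.hasAbsSum) fun i =>
      sub_le_iff_le_add.1 (le_of_abs_sub_le (hle i)).1)
    (hg.mono (hh.add hd.hasAbsSum) fun i => (le_of_abs_sub_le (hle i)).2)

theorem HasAbsSum.exists_of_abs_sub_le (hZ : IsDedekindComplete Z) {g h d : ι → Z} {w b : Z}
    (hh : HasAbsSum h w) (hd : HasPosSum d b) (hle : ∀ i, |g i - h i| ≤ d i) :
    ∃ z, HasAbsSum g z := by
  obtain ⟨p, q, zp, zq, hp, hq, hhp, rfl⟩ := hh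
  -- The shift by `d` makes `g - h` non-negative and keeps it below `d + d`; then `g = (p + (g - h +
  -- d)) - (q + d)`.
  obtain ⟨y, hy⟩ := HasPosSum.exists_of_le hZ (g := fun i => g i - h i + d i)
    (fun i => le_of_sub_eq_sub (le_of_abs_sub_le (hle i)).1 (by abel))
    (fun i => add_le_add_left (abs_le'.1 (hle i)).1 _) (hd.add hd)
  exact ⟨_, _, _, _, _, hp.add hy, hq.add hd, fun i => by rw [hhp]; abel, rfl⟩

theorem HasAbsSum.seqLim [Countable ι] {g : ι → Z} {z : Z} (h : HasAbsSum g z) :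
    SeqLim (fun J : Finset ι => ∑ i ∈ J, g i) z := by
  classical
  obtain ⟨p, q, zp, zq, hp, hq, hgp, rfl⟩ := h
  obtain ⟨e, hm, he, h₁⟩ := hp.exists_antitone
  obtain ⟨e', hm', he', h₂⟩ := hq.exists_antitone
  refine ⟨fun n => e n + e' n, hm.add hm', isGLB_range_add_antitone hm hm' he he', fun n => ?_⟩
  obtain ⟨J₁, h₁⟩ := h₁ n
  obtain ⟨J₂, h₂⟩ := h₂ n
  refine ⟨J₁ ∪ J₂, fun J hJ => ?_⟩
  have a₁ := h₁ J (Finset.subset_union_left.trans hJ)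
  have a₂ := h₂ J (Finset.subset_union_right.trans hJ)
  have b₁ := hp.sum_le J
  have b₂ := hq.sum_le J
  simp only [hgp, Finset.sum_sub_distrib]
  refine abs_sub_le_of_le ?_ ?_
  · exact le_of_sub_eq_sub (add_le_add (add_le_add a₁ b₂) (he'.1 ⟨n, rfl⟩)) (by abel)
  · exact le_of_sub_eq_sub (add_le_add (add_le_add a₂ b₁) (he.1 ⟨n, rfl⟩)) (by abel)

end Sums

/-! ### Monotonicity and order continuity of the product -/

section RieszProduct

variable {X : Type v} [AddCommGroup X] [Lattice X] [Module ℝ X]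
variable {Y : Type w} [AddCommGroup Y] [Lattice Y] [Module ℝ Y]
variable {Z : Type u} [AddCommGroup Z] [Lattice Z] [Module ℝ Z]
variable {c : ConvMode} {B : X →ₗ[ℝ] Y →ₗ[ℝ] Z}

theorem IsRieszProduct.nonneg (hB : IsRieszProduct c B) {x : X} {y : Y} (hx : 0 ≤ x)
    (hy : 0 ≤ y) : 0 ≤ B x y := by
  simpa using hB.isotone 0 x 0 y le_rfl hx le_rfl hy

variable [IsOrderedAddMonoid Z]

theorem IsRieszProduct.mono_left [IsOrderedAddMonoid X] (hB : IsRieszProduct c B) {x x' : X} {y : Y} (hx : x ≤ x')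
    (hy : 0 ≤ y) : B x y ≤ B x' y := by
  have := hB.nonneg (sub_nonneg.2 hx) hy
  simpa using this

theorem IsRieszProduct.mono_right [IsOrderedAddMonoid Y] (hB : IsRieszProduct c B) {x : X} {y y' : Y} (hx : 0 ≤ x)
    (hy : y ≤ y') : B x y ≤ B x y' := by
  have := hB.nonneg hx (sub_nonneg.2 hy)
  simpa using this

theorem IsRieszProduct.abs_sub_le [IsOrderedAddMonoid X] (hB : IsRieszProduct c B)
    {x x' d : X} {y : Y}
    (h : |x - x'| ≤ d) (hy : 0 ≤ y) : |B x y - B x' y| ≤ B d y := by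
  obtain ⟨h₁, h₂⟩ := le_of_abs_sub_le h
  refine abs_sub_le_of_le ?_ ?_
  · simpa using hB.mono_left h₁ hy
  · simpa using hB.mono_left h₂ hy

/-- Continuity gives a limit in mode `c`, hence an order limit, and the order limit of a decreasing
net is its infimum. The index is lifted because continuity is stated for nets indexed in the
universe of `X`. -/
theorem IsRieszProduct.isGLB_left [IsOrderedAddMonoid X] (hZ : IsWeaklySigmaDistributive Z)
    (hB : IsRieszProduct c B)
    {u : ℕ → X} (hu : Antitone u) (hu' : IsGLB (Set.range u) 0) {y : Y} (hy : 0 ≤ y) :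
    IsGLB (Set.range fun n => B (u n) y) 0 := by
  have h₁ : OrderLim (fun i : ULift.{v} ℕ => u i.down) 0 :=
    orderLim_of_antitone_of_isGLB (fun _ _ h => hu h) (by rwa [ULift.range_comp_down u])
  have h₂ := (hB.continuous_left y _ _ _ h₁).orderLim hZ
  have h₃ := h₂.isGLB_of_antitone fun m n h => hB.mono_left (hu h) hy
  rw [ULift.range_comp_down fun n => B (u n) y] at h₃
  simpa using h₃

theorem IsRieszProduct.hasPosSum_right [IsOrderedAddMonoid Y] (hZ : IsWeaklySigmaDistributive Z)
    (hB : IsRieszProduct c B) {g : ℕ → Y} {y : Y} (hg : HasPosSum g y) {x : X} (hx : 0 ≤ x) :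
    HasPosSum (fun i => B x (g i)) (B x y) := by
  refine ⟨fun i => hB.nonneg hx (hg.1 i), ?_⟩
  have hm := HasPosSum.monotone_sum hg.1
  have h₁ : OrderLim (fun J : ULift.{w} (Finset ℕ) => ∑ j ∈ J.down, g j) y := by
    refine orderLim_of_monotone_of_isLUB (fun _ _ h => hm h) ?_
    rw [ULift.range_comp_down fun J : Finset ℕ => ∑ j ∈ J, g j]
    exact hg.2
  have h₂ := (hB.continuous_right x _ _ _ h₁).orderLim hZ
  have h₃ := h₂.isLUB_of_monotone fun m n h => hB.mono_right hx (hm h)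
  rw [ULift.range_comp_down fun J : Finset ℕ => B x (∑ j ∈ J, g j)] at h₃
  simpa only [map_sum] using h₃

end RieszProduct

/-! ### Vector measures on countable families -/

section RieszMeasure

variable {Ω : Type u} [MeasurableSpace Ω]
variable {Y : Type w} [AddCommGroup Y] [Lattice Y] [IsOrderedAddMonoid Y]
variable {Z : Type v} [AddCommGroup Z] [Lattice Z]

/-- A countable family becomes a sequence by padding with empty sets. A general `T` covers both `μ`
and `A ↦ B x (μ A)`. -/
theorem hasPosSum_of_forall_seq {T : Set Ω → Z} (h0 : T ∅ = 0)
    (h : ∀ A : ℕ → Set Ω, (∀ n, MeasurableSet (A n)) →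
      Pairwise (fun m n => Disjoint (A m) (A n)) → HasPosSum (fun n => T (A n)) (T (⋃ n, A n)))
    {ι : Type*} [Countable ι] {s : ι → Set Ω} (hs : ∀ i, MeasurableSet (s i))
    (hd : Pairwise fun i j => Disjoint (s i) (s j)) :
    HasPosSum (fun i => T (s i)) (T (⋃ i, s i)) := by
  obtain ⟨e, he⟩ := exists_injective_nat ι
  refine HasPosSum.of_extend he ?_
  have h₁ := h (Function.extend e s ⊥) (fun n => ?_) (hd.disjoint_extend_bot (he.factorsThrough s))
  · convert h₁ using 1
    · ext n
      by_cases hn : ∃ i, e i = n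
      · obtain ⟨i, rfl⟩ := hn
        simp [he.extend_apply]
      · simp [Function.extend_apply' _ _ _ hn, h0]
    · exact congrArg T (iSup_extend_bot he s).symm
  · by_cases hn : ∃ i, e i = n
    · obtain ⟨i, rfl⟩ := hn
      simpa [he.extend_apply] using hs i
    · simp [Function.extend_apply' _ _ _ hn]

variable {μ : Set Ω → Y}

theorem IsRieszMeasure.hasPosSum_seq (hμ : IsRieszMeasure μ) {A : ℕ → Set Ω}
    (hA : ∀ n, MeasurableSet (A n)) (hd : Pairwise fun m n => Disjoint (A m) (A n)) :
    HasPosSum (fun n => μ (A n)) (μ (⋃ n, A n)) :=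
  ⟨fun n => hμ.nonneg _ (hA n), (hμ.sigma_additive A hA hd).isLUB_of_monotone
    (HasPosSum.monotone_sum fun n => hμ.nonneg _ (hA n))⟩

theorem IsRieszMeasure.empty (hμ : IsRieszMeasure μ) : μ ∅ = 0 := by
  have h := hμ.hasPosSum_seq (A := fun _ => ∅) (by simp) fun _ _ _ => disjoint_bot_left
  have h₂ := h.sum_le {0, 1}
  simp only [Set.iUnion_empty] at h₂
  rw [Finset.sum_pair zero_ne_one] at h₂
  exact le_antisymm (by simpa using h₂) (hμ.nonneg _ .empty)

theorem IsRieszMeasure.mono (hμ : IsRieszMeasure μ) {A A' : Set Ω} (hA : MeasurableSet A)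
    (hA' : MeasurableSet A') (h : A ⊆ A') : μ A ≤ μ A' := by
  have h₁ := hasPosSum_of_forall_seq hμ.empty (fun _ => hμ.hasPosSum_seq)
    (s := fun b : Bool => cond b A (A' \ A)) (by simp [hA, hA'.diff hA])
    (by rintro (_ | _) (_ | _) h <;> simp_all [Set.disjoint_sdiff_left, Set.disjoint_sdiff_right])
  have h₂ := h₁.sum_le {true}
  rwa [Finset.sum_singleton, ← Set.union_eq_iUnion, Set.union_sdiff_self,
    Set.union_eq_self_of_subset_left h] at h₂

variable {X : Type*} [AddCommGroup X] [Lattice X] [Module ℝ X]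
variable [Module ℝ Y] [IsOrderedAddMonoid Z] [Module ℝ Z] {c : ConvMode} {B : X →ₗ[ℝ] Y →ₗ[ℝ] Z}

theorem IsRieszMeasure.hasPosSum_prod (hZ : IsWeaklySigmaDistributive Z)
    (hB : IsRieszProduct c B) (hμ : IsRieszMeasure μ) {x : X} (hx : 0 ≤ x) {ι : Type*}
    [Countable ι] {s : ι → Set Ω} (hs : ∀ i, MeasurableSet (s i))
    (hd : Pairwise fun i j => Disjoint (s i) (s j)) :
    HasPosSum (fun i => B x (μ (s i))) (B x (μ (⋃ i, s i))) :=
  hasPosSum_of_forall_seq (T := fun A => B x (μ A)) (by simp [hμ.empty])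
    (fun _ hA hd => hB.hasPosSum_right hZ (hμ.hasPosSum_seq hA hd) hx) hs hd

end RieszMeasure

/-! ### Partitions adapted to given sets -/

section Partitions

variable {Ω : Type u} [MeasurableSpace Ω]

instance MeasPartition.instCountableCells {A : Set Ω} (P : MeasPartition A) :
    Countable P.cells :=
  P.countable

instance MeasPartition.instNonempty : Nonempty (MeasPartition (Set.univ : Set Ω)) :=
  MeasPartition.nonempty_of_measurableSet .univ

theorem MeasPartition.pairwise_disjoint {A : Set Ω} (P : MeasPartition A) :
    Pairwise fun α β : P.cells => Disjoint α.1 β.1 :=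
  fun α β h => P.disjoint _ α.2 _ β.2 fun h' => h (Subtype.ext h')

theorem MeasPartition.iUnion_cells {A : Set Ω} (P : MeasPartition A) :
    ⋃ α : P.cells, α.1 = A := by
  rw [← Set.sUnion_eq_iUnion, P.covers]

/-- Every sufficiently fine partition is adapted to a given countable disjoint family. -/
theorem exists_forall_ge_subset_or {ι : Type*} [Countable ι] (A : ι → Set Ω) (hA : ∀ n, MeasurableSet (A n))
    (hd : Pairwise fun m n => Disjoint (A m) (A n)) :
    ∃ P₀ : MeasPartition (Set.univ : Set Ω), ∀ P, P₀ ≤ P → ∀ β ∈ P.cells,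
      (∃ n, β ⊆ A n) ∨ Disjoint β (⋃ n, A n) := by
  refine ⟨⟨{β | β.Nonempty ∧ ((∃ n, β = A n) ∨ β = (⋃ n, A n)ᶜ)}, ?_, ?_, ?_, ?_, ?_⟩, ?_⟩
  · refine ((Set.countable_range A).union (Set.countable_singleton (⋃ n, A n)ᶜ)).mono ?_
    rintro β ⟨-, ⟨n, rfl⟩ | rfl⟩
    exacts [Or.inl ⟨n, rfl⟩, Or.inr rfl]
  · rintro β ⟨-, ⟨n, rfl⟩ | rfl⟩
    exacts [hA n, (MeasurableSet.iUnion hA).compl]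
  · exact fun β h => h.1
  · have hc : ∀ n, Disjoint (A n) (⋃ n, A n)ᶜ := fun n =>
      Set.disjoint_compl_right_iff_subset.2 (Set.subset_iUnion A n)
    rintro β ⟨-, ⟨n, rfl⟩ | rfl⟩ γ ⟨-, ⟨m, rfl⟩ | rfl⟩ h
    · exact hd fun h' => h (h' ▸ rfl)
    · exact hc n
    · exact (hc m).symm
    · exact absurd rfl h
  · refine Set.eq_univ_of_forall fun ω => ?_
    by_cases hω : ω ∈ ⋃ n, A n
    · obtain ⟨n, hn⟩ := Set.mem_iUnion.1 hω
      exact ⟨A n, ⟨⟨ω, hn⟩, Or.inl ⟨n, rfl⟩⟩, hn⟩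
    · exact ⟨_, ⟨⟨ω, hω⟩, Or.inr rfl⟩, hω⟩
  · intro P hP β hβ
    obtain ⟨_, ⟨-, ⟨n, rfl⟩ | rfl⟩, h⟩ := hP β hβ
    · exact Or.inl ⟨n, h⟩
    · exact Or.inr (Set.disjoint_left.2 fun ω hω => h hω)

theorem exists_forall_ge_subset_or_disjoint {N : Set Ω} (hN : MeasurableSet N) :
    ∃ P₀ : MeasPartition (Set.univ : Set Ω), ∀ P, P₀ ≤ P → ∀ β ∈ P.cells,
      β ⊆ N ∨ Disjoint β N := by
  simpa using exists_forall_ge_subset_or (fun _ : Unit => N) (fun _ => hN)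
    fun a b h => absurd (Subsingleton.elim a b) h

end Partitions

/-! ### Partition sums and the two integrals -/

section Integrals

variable {Ω : Type*} [MeasurableSpace Ω]
variable {X : Type*} [AddCommGroup X] [Lattice X] [IsOrderedAddMonoid X] [Module ℝ X]
variable {Y : Type*} [AddCommGroup Y] [Lattice Y] [IsOrderedAddMonoid Y] [Module ℝ Y]
variable {Z : Type*} [AddCommGroup Z] [Lattice Z] [IsOrderedAddMonoid Z] [Module ℝ Z]
variable {c : ConvMode} {B : X →ₗ[ℝ] Y →ₗ[ℝ] Z} {μ : Set Ω → Y}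

omit [IsOrderedAddMonoid X] in
theorem HasElementaryIntegralNonneg.exists_hasPosSum (hZ : IsWeaklySigmaDistributive Z)
    (hB : IsRieszProduct c B) (hμ : IsRieszMeasure μ) {F : Ω → X} {z : Z}
    (hF : HasElementaryIntegralNonneg B μ F z) :
    ∃ P₀ : MeasPartition (Set.univ : Set Ω), ∀ P, P₀ ≤ P → ∀ p : P.cells → Ω,
      (∀ α, p α ∈ α.1) → HasPosSum (fun α => B (F (p α)) (μ α.1)) z := by
  obtain ⟨hF0, a, A, hA, hz⟩ := hF
  obtain ⟨P₀, hP₀⟩ := exists_forall_ge_subset_or A hA.measurable hA.disjoint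
  refine ⟨P₀, fun P hP p hp => ?_⟩
  -- `0 ≤ F` says nothing about `a n` when `A n` is empty; positive parts remove this exception
  -- without changing any term.
  have ha : ∀ n, B (a n) (μ (A n)) = B (a n)⁺ (μ (A n)) := fun n => by
    rcases (A n).eq_empty_or_nonempty with h | ⟨ω, hω⟩
    · simp [h, hμ.empty]
    · rw [posPart_of_nonneg (hA.eq_on n ω hω ▸ hF0 ω)]
  have hr : HasPosSum (fun n => B (a n)⁺ (μ (A n))) z := by
    have h0 : ∀ n, 0 ≤ B (a n)⁺ (μ (A n)) := fun n =>
      hB.nonneg (posPart_nonneg _) (hμ.nonneg _ (hA.measurable n))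
    simp only [ha] at hz
    exact HasPosSum.of_range h0 (hz.isLUB_of_monotone fun m n h =>
      HasPosSum.monotone_sum h0 (Finset.range_mono h))
  -- Rows sum by `σ`-additivity. A column has at most one nonzero term, because `α` lies in a single
  -- `A n` or misses them all, and then `F` vanishes on it.
  refine HasPosSum.swap (g := fun n α => B (a n)⁺ (μ (A n ∩ α.1))) (fun n => ?_) (fun α => ?_) hr
  · have h := hμ.hasPosSum_prod hZ hB (posPart_nonneg (a n)) (s := fun α : P.cells => A n ∩ α.1)
      (fun α => (hA.measurable n).inter (P.measurable _ α.2))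
      fun α β h => (P.pairwise_disjoint h).mono Set.inter_subset_right Set.inter_subset_right
    rwa [← Set.inter_iUnion, P.iUnion_cells, Set.inter_univ] at h
  · have hn : ∀ n, 0 ≤ B (a n)⁺ (μ (A n ∩ α.1)) := fun n => hB.nonneg (posPart_nonneg _)
      (hμ.nonneg _ ((hA.measurable n).inter (P.measurable _ α.2)))
    have h0 : ∀ n, Disjoint (A n) α.1 → B (a n)⁺ (μ (A n ∩ α.1)) = 0 := fun n h => by
      rw [h.inter_eq, hμ.empty, map_zero]
    rcases hP₀ P hP α.1 α.2 with ⟨n, h⟩ | h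
    · have h₁ := hasPosSum_single n (hn n) fun m hm =>
        h0 m ((hA.disjoint hm).mono_right h)
      have h₂ := hA.eq_on n _ (h (hp α))
      rwa [Set.inter_eq_self_of_subset_right h, ← h₂, posPart_of_nonneg (hF0 _)] at h₁
    · rw [hA.eq_zero _ (Set.disjoint_left.1 h (hp α)), map_zero, LinearMap.zero_apply]
      simp only [h0 _ (h.symm.mono_left (Set.subset_iUnion A _))]
      exact hasPosSum_zero

theorem HasElementaryIntegral.exists_hasAbsSum (hZ : IsWeaklySigmaDistributive Z)
    (hB : IsRieszProduct c B) (hμ : IsRieszMeasure μ) {F : Ω → X} {z : Z}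
    (hF : HasElementaryIntegral B μ F z) :
    ∃ P₀ : MeasPartition (Set.univ : Set Ω), ∀ P, P₀ ≤ P → ∀ p : P.cells → Ω,
      (∀ α, p α ∈ α.1) → HasAbsSum (fun α => B (F (p α)) (μ α.1)) z := by
  obtain ⟨-, z₁, z₂, h₁, h₂, rfl⟩ := hF
  obtain ⟨P₁, h₁⟩ := h₁.exists_hasPosSum hZ hB hμ
  obtain ⟨P₂, h₂⟩ := h₂.exists_hasPosSum hZ hB hμ
  obtain ⟨P₀, hP₁, hP₂⟩ := exists_ge_ge P₁ P₂
  refine ⟨P₀, fun P hP p hp => ⟨_, _, _, _, h₁ P (hP₁.trans hP) p hp, h₂ P (hP₂.trans hP) p hp,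
    fun α => ?_, rfl⟩⟩
  rw [← LinearMap.sub_apply, ← map_sub, Pi.posPart_apply, Pi.negPart_apply, posPart_sub_negPart]

theorem HasElementaryIntegral.mono (hZ : IsWeaklySigmaDistributive Z) (hB : IsRieszProduct c B)
    (hμ : IsRieszMeasure μ) {F G : Ω → X} {z w : Z} (hF : HasElementaryIntegral B μ F z)
    (hG : HasElementaryIntegral B μ G w) (h : F ≤ G) : z ≤ w := by
  obtain ⟨P₁, h₁⟩ := hF.exists_hasAbsSum hZ hB hμ
  obtain ⟨P₂, h₂⟩ := hG.exists_hasAbsSum hZ hB hμ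
  obtain ⟨P, hP₁, hP₂⟩ := exists_ge_ge P₁ P₂
  choose p hp using fun α : P.cells => P.nonempty _ α.2
  exact (h₁ P hP₁ p hp).mono (h₂ P hP₂ p hp) fun α =>
    hB.mono_left (h _) (hμ.nonneg _ (P.measurable _ α.2))

theorem HasElementaryIntegral.exists_abs_sub_le (hZ : IsDedekindComplete Z)
    (hZ' : IsWeaklySigmaDistributive Z) (hB : IsRieszProduct c B) (hμ : IsRieszMeasure μ)
    {F f : Ω → X} {z : Z} (hF : HasElementaryIntegral B μ F z) {N : Set Ω}
    (hN : MeasurableSet N) (hN0 : μ N = 0) {u : X} (hu : 0 ≤ u)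
    (hf : ∀ ω, ω ∉ N → |F ω - f ω| ≤ u) :
    ∃ P₀ : MeasPartition (Set.univ : Set Ω), ∀ P, P₀ ≤ P → ∀ p : P.cells → Ω,
      (∀ α, p α ∈ α.1) → ∃ w, HasAbsSum (fun α => B (f (p α)) (μ α.1)) w ∧
        |w - z| ≤ B u (μ Set.univ) := by
  obtain ⟨P₁, h₁⟩ := hF.exists_hasAbsSum hZ' hB hμ
  obtain ⟨P₂, h₂⟩ := exists_forall_ge_subset_or_disjoint hN
  obtain ⟨P₀, hP₁, hP₂⟩ := exists_ge_ge P₁ P₂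
  refine ⟨P₀, fun P hP p hp => ?_⟩
  have hs := h₁ P (hP₁.trans hP) p hp
  have hd := hμ.hasPosSum_prod hZ' hB hu (fun α : P.cells => P.measurable _ α.2)
    P.pairwise_disjoint
  rw [P.iUnion_cells] at hd
  have hle : ∀ α : P.cells, |B (f (p α)) (μ α.1) - B (F (p α)) (μ α.1)| ≤ B u (μ α.1) :=
    fun α => by
      have hα := hμ.nonneg _ (P.measurable _ α.2)
      -- Cells inside `N` have measure zero; on the others the tag avoids `N`, so the uniform
      -- estimate applies.
      rcases h₂ P (hP₂.trans hP) α.1 α.2 with h | h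
      · have : μ α.1 = 0 := (hN0 ▸ hμ.mono (P.measurable _ α.2) hN h).antisymm hα
        simp [this]
      · refine hB.abs_sub_le ?_ hα
        rw [abs_sub_comm]
        exact hf _ (Set.disjoint_left.1 h (hp α))
  obtain ⟨w, hw⟩ := hs.exists_of_abs_sub_le hZ hd hle
  exact ⟨w, hw, hw.abs_sub_le hs hd hle⟩

theorem PavlakosIntegrable.exists_hasPavlakosIntegral (hZ : IsDedekindComplete Z)
    (hZ' : IsWeaklySigmaDistributive Z) (hB : IsRieszProduct c B) (hμ : IsRieszMeasure μ)
    {f : Ω → X} (hf : PavlakosIntegrable B μ f) : ∃ z, HasPavlakosIntegral B μ f z := by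
  obtain ⟨hm, F, hF, hs, hu⟩ := hf
  choose s hs using hs
  have hsm : Monotone s := fun m n h => (hs m).mono hZ' hB hμ (hs n) (hF h)
  obtain ⟨N, hN, hN0, u, hua, hug, h⟩ := id hu
  have hu0 : ∀ n, 0 ≤ u n := fun n => hug.1 ⟨n, rfl⟩
  -- Both `s 0` and `s n` are compared with the same partition sum of `f`, each at a cost of at most
  -- `B (u 0) (μ Ω)`.
  have hle : ∀ n, s n ≤ s 0 + B (u 0) (μ Set.univ) + B (u 0) (μ Set.univ) := fun n => by
    obtain ⟨P₁, h₁⟩ := (hs 0).exists_abs_sub_le hZ hZ' hB hμ hN hN0 (hu0 0) (h 0)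
    obtain ⟨P₂, h₂⟩ := (hs n).exists_abs_sub_le hZ hZ' hB hμ hN hN0 (hu0 n) (h n)
    obtain ⟨P, hP₁, hP₂⟩ := exists_ge_ge P₁ P₂
    choose p hp using fun α : P.cells => P.nonempty _ α.2
    obtain ⟨w₁, hw₁, h₁⟩ := h₁ P hP₁ p hp
    obtain ⟨w₂, hw₂, h₂⟩ := h₂ P hP₂ p hp
    have hw := hw₂.mono hw₁ fun _ => le_rfl
    have h₃ := sub_le_iff_le_add.1 (le_of_abs_sub_le h₂).1
    refine h₃.trans (add_le_add (hw.trans (le_of_abs_sub_le h₁).2) ?_)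
    exact hB.mono_left (hua n.zero_le) (hμ.nonneg _ .univ)
  obtain ⟨z, hz⟩ := hZ (Set.range s) (Set.range_nonempty _)
    ⟨_, by rintro _ ⟨n, rfl⟩; exact hle n⟩
  refine ⟨z, hm, F, hF, hu, s, hs, SeqLim.orderLim ⟨fun n => z - s n,
    fun m n h => sub_le_sub_left (hsm h) _, isGLB_range_sub_of_isLUB hz,
    fun n => ⟨n, fun m hm => abs_sub_le_of_le ?_ ?_⟩⟩⟩
  · simpa using hsm hm
  · exact (hz.1 ⟨m, rfl⟩).trans (le_add_of_nonneg_right (sub_nonneg.2 (hz.1 ⟨n, rfl⟩)))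

theorem HasPavlakosIntegral.hasSStarPartitionIntegral (hZ : IsDedekindComplete Z)
    (hZ' : IsWeaklySigmaDistributive Z) (hB : IsRieszProduct c B) (hμ : IsRieszMeasure μ)
    {f : Ω → X} {z : Z} (hf : HasPavlakosIntegral B μ f z) :
    HasSStarPartitionIntegral c B μ Set.univ f z := by
  classical
  obtain ⟨-, F, hF, ⟨N, hN, hN0, u, hua, hug, h⟩, s, hs, hz⟩ := hf
  have hsm : Monotone s := fun m n h => (hs m).mono hZ' hB hμ (hs n) (hF h)
  have hsz := hz.isLUB_of_monotone hsm
  -- `Q n` is fixed before the choice function, so the estimates are uniform in it.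
  choose Q hQ using fun n =>
    (hs n).exists_abs_sub_le hZ hZ' hB hμ hN hN0 (hug.1 ⟨n, rfl⟩) (h n)
  intro δ
  let p : ∀ P : MeasPartition (Set.univ : Set Ω), P.cells → Ω := fun P α =>
    δ ⟨α.1, P.nonempty α.1 α.2⟩
  have hp : ∀ P α, p P α ∈ α.1 := fun P α => (δ ⟨α.1, P.nonempty α.1 α.2⟩).2
  -- The default `0` can only occur for partitions that do not refine `Q 0`.
  let S : MeasPartition (Set.univ : Set Ω) → Z := fun P =>
    if h : ∃ w, HasAbsSum (fun α => B (f (p P α)) (μ α.1)) w then h.choose else 0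
  have hS : ∀ P w, HasAbsSum (fun α => B (f (p P α)) (μ α.1)) w →
      HasAbsSum (fun α => B (f (p P α)) (μ α.1)) (S P) := fun P w hw => by
    have h : ∃ w, HasAbsSum (fun α => B (f (p P α)) (μ α.1)) w := ⟨w, hw⟩
    simp only [S, dif_pos h]
    exact h.choose_spec
  refine ⟨S, ⟨Q 0, fun P hP => ?_⟩, SeqLim.lim c
    ⟨fun n => B (u n) (μ Set.univ) + (z - s n), ?_, ?_, fun n => ⟨Q n, fun P hP => ?_⟩⟩⟩
  · obtain ⟨w, hw, -⟩ := hQ 0 P hP (p P) (hp P)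
    exact (hS P w hw).seqLim.lim c
  · exact fun m n h => add_le_add (hB.mono_left (hua h) (hμ.nonneg _ .univ))
      (sub_le_sub_left (hsm h) _)
  · exact isGLB_range_add_antitone (fun m n h => hB.mono_left (hua h) (hμ.nonneg _ .univ))
      (fun m n h => sub_le_sub_left (hsm h) _) (hB.isGLB_left hZ' hua hug (hμ.nonneg _ .univ))
      (isGLB_range_sub_of_isLUB hsz)
  · obtain ⟨w, hw, hwz⟩ := hQ n P hP (p P) (hp P)
    have hwS : S P = w :=
      ((hS P w hw).mono hw fun _ => le_rfl).antisymm (hw.mono (hS P w hw) fun _ => le_rfl)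
    obtain ⟨h₁, h₂⟩ := le_of_abs_sub_le hwz
    have h₃ : 0 ≤ z - s n := sub_nonneg.2 (hsz.1 ⟨n, rfl⟩)
    rw [hwS]
    beta_reduce
    refine abs_sub_le_of_le (le_of_sub_eq_sub h₁ (by abel)) ?_
    -- The required upper bound exceeds `s n + B (u n) (μ Ω)` by `2 (z - s n)`, hence `h₃` twice.
    -- The lower bound needs no slack.
    exact le_of_sub_eq_sub (add_le_add h₂ (add_le_add h₃ h₃)) (by abel)

omit [Lattice X] [IsOrderedAddMonoid X] [Lattice Y] [IsOrderedAddMonoid Y] in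
theorem HasSStarPartitionIntegral.unique (hZ : IsWeaklySigmaDistributive Z) {f : Ω → X} {z w : Z}
    (hz : HasSStarPartitionIntegral c B μ Set.univ f z)
    (hw : HasSStarPartitionIntegral c B μ Set.univ f w) : z = w := by
  -- One choice function suffices: `S` and `T` are limits of the same subsums on fine partitions,
  -- hence eventually equal.
  obtain ⟨S, ⟨P, hP⟩, hS⟩ := hz fun α => ⟨α.2.some, α.2.some_mem⟩
  obtain ⟨T, ⟨Q, hQ⟩, hT⟩ := hw fun α => ⟨α.2.some, α.2.some_mem⟩
  obtain ⟨R, hPR, hQR⟩ := exists_ge_ge P Q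
  have hS := hS.orderLim hZ
  have hT := hT.orderLim hZ
  have hP := fun P' h => (hP P' (hPR.trans h)).orderLim hZ
  have hQ := fun P' h => (hQ P' (hQR.trans h)).orderLim hZ
  exact (hS.le_of_orderLim hT fun P' h =>
      (hP P' h).le_of_orderLim (hQ P' h) (i₀ := ∅) fun _ _ => le_rfl).antisymm
    (hT.le_of_orderLim hS fun P' h =>
      (hQ P' h).le_of_orderLim (hP P' h) (i₀ := ∅) fun _ _ => le_rfl)

end Integrals

/-! ### Existence, uniqueness and equality of the integrals -/

theorem mainTheorem3 {Ω X Y Z : Type*} [MeasurableSpace Ω]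
    [AddCommGroup X] [Lattice X] [IsOrderedAddMonoid X] [Module ℝ X] [IsOrderedModule ℝ X]
    [AddCommGroup Y] [Lattice Y] [IsOrderedAddMonoid Y] [Module ℝ Y] [IsOrderedModule ℝ Y]
    [AddCommGroup Z] [Lattice Z] [IsOrderedAddMonoid Z] [Module ℝ Z] [IsOrderedModule ℝ Z]
    (hX : IsArchimedeanRiesz X) (hY : IsArchimedeanRiesz Y)
    (hZ : IsDedekindComplete Z) (hZ' : IsWeaklySigmaDistributive Z)
    (c : ConvMode) (B : X →ₗ[ℝ] Y →ₗ[ℝ] Z) (hB : IsRieszProduct c B)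
    (μ : Set Ω → Y) (hμ : IsRieszMeasure μ)
    (f : Ω → X) (hf : PavlakosIntegrable B μ f) :
    ∃ z : Z, (∀ z', HasPavlakosIntegral B μ f z' ↔ z' = z) ∧
      (∀ z', HasSStarPartitionIntegral c B μ Set.univ f z' ↔ z' = z) := by
  obtain ⟨z, hz⟩ := hf.exists_hasPavlakosIntegral hZ hZ' hB hμ
  have hS := hz.hasSStarPartitionIntegral hZ hZ' hB hμ
  refine ⟨z, fun z' => ⟨fun h => ?_, fun h => h ▸ hz⟩, fun z' => ⟨fun h => ?_, fun h => h ▸ hS⟩⟩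
  · exact (h.hasSStarPartitionIntegral hZ hZ' hB hμ).unique hZ' hS
  · exact h.unique hZ' hS
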